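/- **Setting.** A word is a finite (possibly empty) word over $\{1,2\}$; $|x|$ is the sum of its digits, $\#x$ the number of its digits, and $d(x)$ the number of its digits equal to $2$. The Young–Fibonacci graph $\mathbb{YF}$ has all words as vertices; $x$ is joined by an upward edge to each word obtained from $x$ either by replacing the leftmost $1$ by $2$, or by inserting a $1$ to the left of the leftmost $1$ (i.e. at any place preceded only by $2$'s; at any place at all if $x$ contains no $1$). Edges may be traversed in both directions. Let $h(x,y)$ be the length of the longest common suffix of $x$ and $y$. **Lower function.** For a word $x$, $0\le i\le |x|$ and $0\le z\le \#x$, the rational number $f(x,i,z)$ is defined as follows. If $x=\alpha_1\dots\alpha_n$ and $\alpha_{m+1}+\dots+\alpha_n=i$ for some (necessarily unique) $0\le m\le n$, then $$f(x,i,0)=\prod_{k=m+1}^{n}\frac{1}{-\alpha_{m+1}-\dots-\alpha_k}\cdot\prod_{k=1}^{m}\frac{1}{\alpha_k+\dots+\alpha_m};$$ if there is no such $m$, then $f(x,i,0)=0$. For $z>0$: $f(x1,0,z)=f(x1,0,0)$; $f(x1,i,z)=f(x1,i,0)+f(x,i-1,z-1)$ if $i>0$; $f(x2,i,z)=\dfrac{f(x11,i,z+1)}{1-i}$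 if $i\neq 1$, and $f(x2,1,z)=0$. (Here $x1$, $x2$, $x11$ are concatenations.) **Upper function.** Write $x=1^{\beta_{d}}\,2\,1^{\beta_{d-1}}\,2\cdots 2\,1^{\beta_1}\,2\,1^{\beta_0}$ with $d=d(x)$ and $\beta_k\ge 0$. For $1\le m\le d(x)$ put $g(x,m)=\beta_0+\dots+\beta_{m-1}+2m-1$. **Trajectories.** For integers $Y\ge X\ge 0$, a $(Y;X)$-trajectory is a finite sequence $\Delta=(\Delta_0,\dots,\Delta_k)$, $k\ge 0$, of non-negative integers with $\Delta_0=Y$, $\Delta_k=X$ and $\Delta_i-\Delta_{i-1}=\pm1$ for $1\le i\le k$. The step $i$ is an up-step if $\Delta_i-\Delta_{i-1}=1$; $s(\Delta)$ is the number of up-steps, and for $1\le j\le s(\Delta)$ we let $e(\Delta,j)=\Delta_{\gamma}$, where step $\gamma$ is the $j$-th up-step. **Theorem.** Let $x,y$ be words with $|y|\ge|x|$, let $z=h(x,y)$, and let $\Delta$ be a $(|y|;|x|)$-trajectory. Let $d(x,y,\Delta)$ be the (finite) number of paths $y=y_0,y_1,\dots,y_k=x$ in $\mathbb{YF}$ (consecutive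 vertices are joined by an edge; vertices may repeat), where $k$ is the length of $\Delta$, such that $|y_i|=\Delta_i$ for all $0\le i\le k$. Then $$d(x,y,\Delta)=\sum_{i=0}^{|x|} f(x,i,z)\prod_{j=1}^{d(y)}\bigl(g(y,j)-i\bigr)\prod_{j=1}^{s(\Delta)}\bigl(e(\Delta,j)-i\bigr).$$ -/

import Mathlib

namespace YoungFib

/-- The two digits of the alphabet `{1, 2}`. -/
inductive Digit : Type
  | one : Digit
  | two : Digit

/-- The numerical value of a digit. -/
def Digit.val : Digit → ℕ
  | .one => 1
  | .two => 2

/-- Vertices of the Young–Fibonacci graph: finite words over `{1, 2}`, written from left to right. -/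
abbrev Word : Type := List Digit

/-- The rank `|x|`: the sum of the digits of `x`. -/
def rank (x : Word) : ℕ := (x.map Digit.val).sum

/-- The number `d(x)` of digits `2` in `x`. -/
def twos : Word → ℕ
  | [] => 0
  | .one :: w => twos w
  | .two :: w => twos w + 1

/-- `UpEdge x y`: there is an upward edge from `x` to `y`, i.e. `y` arises from `x` either by
replacing the leftmost `1` by a `2`, or by inserting a `1` at a place such that only digits `2`
stand to the left of that place. -/
def UpEdge (x y : Word) : Prop :=
  (∃ (k : ℕ) (w : Word), x = List.replicate k Digit.two ++ Digit.one :: w ∧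
    y = List.replicate k Digit.two ++ Digit.two :: w) ∨
  (∃ (k : ℕ) (w : Word), x = List.replicate k Digit.two ++ w ∧
    y = List.replicate k Digit.two ++ Digit.one :: w)

theorem UpEdge.rank_eq {x y : Word} (h : UpEdge x y) : rank y = rank x + 1 := by
  rcases h with ⟨k, w, rfl, rfl⟩ | ⟨k, w, rfl, rfl⟩ <;> simp [rank, Digit.val] <;> ring

/-- The Young–Fibonacci graph (edges may be walked in both directions). -/
def YF : SimpleGraph Word where
  Adj x y := UpEdge x y ∨ UpEdge y x
  symm := ⟨fun _ _ h => h.symm⟩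
  loopless := ⟨fun x h => by
    have h1 : UpEdge x x := h.elim id id
    have h2 := h1.rank_eq
    omega⟩

/-- The length of the longest common prefix of two words. -/
def commonPrefix : Word → Word → ℕ
  | .one :: u, .one :: v => commonPrefix u v + 1
  | .two :: u, .two :: v => commonPrefix u v + 1
  | _, _ => 0

/-- `h(x, y)`: the length of the longest common suffix of `x` and `y`. -/
def commonSuffix (x y : Word) : ℕ := commonPrefix x.reverse y.reverse

theorem commonPrefix_isGreatest (u v : Word) :
    IsGreatest {n : ℕ | ∃ u' v' w : Word, u = w ++ u' ∧ v = w ++ v' ∧ w.length = n}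
      (commonPrefix u v) := by
  constructor
  · induction u, v using commonPrefix.induct with
    | case1 u v ih =>
      obtain ⟨u', v', w, h1, h2, h3⟩ := ih
      exact ⟨u', v', Digit.one :: w, by simp [← h1], by simp [← h2], by simp [commonPrefix, h3]⟩
    | case2 u v ih =>
      obtain ⟨u', v', w, h1, h2, h3⟩ := ih
      exact ⟨u', v', Digit.two :: w, by simp [← h1], by simp [← h2], by simp [commonPrefix, h3]⟩
    | case3 u v h1 h2 =>
      refine ⟨u, v, [], rfl, rfl, ?_⟩
      rw [commonPrefix]
      · rfl
      · exact h1
      · exact h2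
  · rintro n ⟨u', v', w, rfl, rfl, rfl⟩
    induction w with
    | nil => simp
    | cons a w ih => cases a <;> simpa [commonPrefix] using ih

/-- `h(x, y)` is the largest `n` such that `x = x' z'` and `y = y' z'` for some words `x'`, `y'`
and some word `z'` with `n` digits. -/
theorem commonSuffix_isGreatest (x y : Word) :
    IsGreatest {n : ℕ | ∃ x' y' z' : Word, x = x' ++ z' ∧ y = y' ++ z' ∧ z'.length = n}
      (commonSuffix x y) := by
  have h := commonPrefix_isGreatest x.reverse y.reverse
  constructor
  · obtain ⟨u', v', w, h1, h2, h3⟩ := h.1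
    refine ⟨u'.reverse, v'.reverse, w.reverse, ?_, ?_, by simpa [commonSuffix] using h3⟩
    · simpa using congrArg List.reverse h1
    · simpa using congrArg List.reverse h2
  · rintro n ⟨x', y', z', rfl, rfl, rfl⟩
    exact h.2 ⟨x'.reverse, y'.reverse, z'.reverse, by simp, by simp, by simp⟩

/-- For `u = α₁…αₘ` and `v = αₘ₊₁…αₙ`, the product of the reciprocals of
`-αₘ₊₁`, `-αₘ₊₁ - αₘ₊₂`, …, `-αₘ₊₁ - … - αₙ` and of `αₘ`, `αₘ + αₘ₋₁`, …, `αₘ + … + α₁`. -/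
def cutWeight (u v : Word) : ℚ :=
  (∏ k ∈ Finset.range v.length, (-(rank (v.take (k + 1)) : ℚ))⁻¹) *
    ∏ k ∈ Finset.range u.length, ((rank (u.drop k) : ℚ))⁻¹

/-- `f(x, y, 0)`: the weight of the cut `x = u v` with `|v| = y` if there is such a cut (it is then
unique, since the digits are positive), and `0` otherwise. -/
def lowerZero (x : Word) (y : ℕ) : ℚ :=
  ∑ m ∈ Finset.range (x.length + 1),
    if rank (x.drop m) = y then cutWeight (x.take m) (x.drop m) else 0

/-- The lower function `f(x, y, z)`, the word `x` being given by its list of digits from right to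
left. The value for `x = ε`, `z > 0`, which lies outside the domain `z ≤ #x`, is set to `0`. -/
def lowerRev : List Digit → ℕ → ℕ → ℚ
  | w, y, 0 => lowerZero w.reverse y
  | [], _, _ + 1 => 0
  | .one :: w, 0, _ + 1 => lowerZero (Digit.one :: w).reverse 0
  | .one :: w, y + 1, z + 1 => lowerZero (Digit.one :: w).reverse (y + 1) + lowerRev w y z
  | .two :: w, y, z + 1 =>
      if y = 1 then 0 else lowerRev (Digit.one :: Digit.one :: w) y (z + 2) / (1 - (y : ℚ))
termination_by w => rank w + twos w
decreasing_by
  all_goals simp [rank, twos, Digit.val]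
  all_goals omega

/-- The lower function `f(x, y, z)`, used for `0 ≤ y ≤ |x|` and `0 ≤ z ≤ #x`. -/
def lower (x : Word) (y z : ℕ) : ℚ := lowerRev x.reverse y z

/-- For a word with digits `1…1 2 1…1 2 … 2 1…1` read from right to left, the length of the `k`-th
run of ones (`k = 0, 1, …`; runs may be empty). -/
def runRev : List Digit → ℕ → ℕ
  | [], _ => 0
  | .one :: w, 0 => runRev w 0 + 1
  | .one :: w, k + 1 => runRev w (k + 1)
  | .two :: _, 0 => 0
  | .two :: w, k + 1 => runRev w k

/-- `βₖ`, where `x = 1^{β_d} 2 1^{β_{d-1}} 2 … 2 1^{β_1} 2 1^{β_0}` and `d = d(x)`. -/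
def run (x : Word) (k : ℕ) : ℕ := runRev x.reverse k

/-- The upper function `g(x, m) = β₀ + … + βₘ₋₁ + 2m - 1`, used for `1 ≤ m ≤ d(x)`. -/
def upper (x : Word) (m : ℕ) : ℤ := ∑ l ∈ Finset.range m, (run x l : ℤ) + 2 * (m : ℤ) - 1

/-- `(Y; X)`-trajectories: finite sequences `Δ₀, …, Δₖ` of non-negative integers from `Y` to
`X ≤ Y` whose consecutive terms differ by `±1`. -/
structure IsTrajectory (Y X : ℕ) (Δ : List ℕ) : Prop where
  le : X ≤ Y
  steps : Δ.IsChain (fun a b => b = a + 1 ∨ a = b + 1)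
  head : Δ.head? = some Y
  last : Δ.getLast? = some X

/-- The term `Δᵢ` of a sequence `Δ₀, …, Δₖ` (used for `0 ≤ i ≤ k`). -/
def level (Δ : List ℕ) (i : ℕ) : ℕ := Δ.getD i 0

/-- The indices `i ∈ {1, …, k}` of the up-steps of `Δ₀, …, Δₖ`. -/
def upSteps (Δ : List ℕ) : Finset ℕ :=
  (Finset.Icc 1 (Δ.length - 1)).filter (fun i => level Δ i = level Δ (i - 1) + 1)

/-- `s(Δ)`: the number of up-steps. -/
def numUp (Δ : List ℕ) : ℕ := (upSteps Δ).card

/-- `γ(Δ, j)`: the index of the `j`-th up-step, for `1 ≤ j ≤ s(Δ)`. -/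
noncomputable def upIndex (Δ : List ℕ) (j : ℕ) : ℕ := Nat.nth (· ∈ upSteps Δ) (j - 1)

/-- The middle function `e(Δ, j) = Δ_{γ(Δ, j)}`: the level reached by the `j`-th up-step. -/
noncomputable def middle (Δ : List ℕ) (j : ℕ) : ℕ := level Δ (upIndex Δ j)

/-- The set of `Δ`-paths from `y` to `x`: walks `y = y₀, y₁, …, yₙ = x` in the Young–Fibonacci
graph whose sequence of ranks `|y₀|, …, |yₙ|` is `Δ`. -/
def pathsAlong (x y : Word) (Δ : List ℕ) : Set (YF.Walk y x) :=
  {p | p.support.map rank = Δ}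

end YoungFib

/-! Fix `x` and put F_i(y) = f(x,i,h(x,y)) ∏_j (g(y,j) - i). Let U and D sum a function over the
upper and over the lower neighbours. Three facts carry the theorem: D F_i = F_i on the levels above
|x| (`downSum_pathTerm`, `pathSource_eq_zero`); U F_i(y) = (|y| + 1 - i) F_i(y) on the levels from
|x| on (`upSum_pathTerm`); and ∑_i F_i is the indicator of `x` on level |x| (`sum_pathTerm`). So,
while a trajectory stays at or above |x|, peeling off its first step multiplies the i-th summand by
e - i for an up-step to level e, and by 1 for a down-step.

The product ∏_j (g(y,j) - i) alone satisfies both relations up to defects on all-2 words; the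
recursion of f in z cancels these. The normalisation is a partial fraction expansion: f(x,i,0) is
the residue at s = -i of ∏ 1/(s + |v|) over the suffixes v of `x` (`sum_cutRev_div`).

A trajectory may also dip below |x|. There F_i is extended by iterating U, so an up-step contributes
1, and UD = DU + 1 gives the factor a - i for a down-step from a ≤ |x| (`downSum_iterate_upSum`).
Each such down-step is undone by a later up-step back to a, so the total is again the product over
up-steps (`stepWeight_mul_prod`).

Words are read from right to left, so that common suffixes become common prefixes and induction
removes the last digit. -/

namespace YoungFib

/-! ### Neighbours and the operators U and D -/

/-- Whether all digits of a word are `2`. -/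
def allTwo : List Digit → Bool
  | [] => true
  | .one :: _ => false
  | .two :: w => allTwo w

/-- The upper neighbours of a word, all words being read from right to left. -/
def upList : List Digit → List (List Digit)
  | [] => [[Digit.one]]
  | .one :: v => (upList v).map (Digit.one :: ·) ++ if allTwo v then [Digit.two :: v] else []
  | .two :: v =>
      (upList v).map (Digit.two :: ·) ++ if allTwo v then [Digit.one :: Digit.two :: v] else []

/-- The lower neighbours of a word, all words being read from right to left. -/
def downList : List Digit → List (List Digit)
  | [] => []
  | .one :: v => (downList v).map (Digit.one :: ·) ++ if allTwo v then [v] else []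
  | .two :: v => (downList v).map (Digit.two :: ·) ++ if allTwo v then [Digit.one :: v] else []

/-- The sum of a function over the upper neighbours. -/
def upSum (F : List Digit → ℚ) (y : List Digit) : ℚ := ((upList y).map F).sum

/-- The sum of a function over the lower neighbours. -/
def downSum (F : List Digit → ℚ) (y : List Digit) : ℚ := ((downList y).map F).sum

@[simp] theorem rank_nil : rank [] = 0 := rfl
@[simp] theorem rank_one (w : Word) : rank (Digit.one :: w) = rank w + 1 := by
  simp [rank, Digit.val, add_comm]
@[simp] theorem rank_two (w : Word) : rank (Digit.two :: w) = rank w + 2 := by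
  simp [rank, Digit.val, add_comm]
theorem rank_cons (d : Digit) (w : Word) : rank (d :: w) = d.val + rank w := by simp [rank]
theorem rank_append (v w : Word) : rank (v ++ w) = rank v + rank w := by simp [rank]
@[simp] theorem rank_reverse (w : Word) : rank w.reverse = rank w := by simp [rank]

@[simp] theorem upSum_nil (F) : upSum F [] = F [Digit.one] := by simp [upSum, upList]
@[simp] theorem upSum_one (F) (v) : upSum F (Digit.one :: v) =
    upSum (fun u => F (Digit.one :: u)) v + if allTwo v then F (Digit.two :: v) else 0 := by
  by_cases h : allTwo v <;> simp [upSum, upList, h, Function.comp_def]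
@[simp] theorem upSum_two (F) (v) : upSum F (Digit.two :: v) =
    upSum (fun u => F (Digit.two :: u)) v +
      if allTwo v then F (Digit.one :: Digit.two :: v) else 0 := by
  by_cases h : allTwo v <;> simp [upSum, upList, h, Function.comp_def]
@[simp] theorem downSum_nil (F) : downSum F [] = 0 := by simp [downSum, downList]
@[simp] theorem downSum_one (F) (v) : downSum F (Digit.one :: v) =
    downSum (fun u => F (Digit.one :: u)) v + if allTwo v then F v else 0 := by
  by_cases h : allTwo v <;> simp [downSum, downList, h, Function.comp_def]
@[simp] theorem downSum_two (F) (v) : downSum F (Digit.two :: v) =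
    downSum (fun u => F (Digit.two :: u)) v + if allTwo v then F (Digit.one :: v) else 0 := by
  by_cases h : allTwo v <;> simp [downSum, downList, h, Function.comp_def]

theorem upSum_add (F G) (y) : upSum (fun u => F u + G u) y = upSum F y + upSum G y := by
  simp [upSum, List.sum_map_add]
theorem downSum_add (F G) (y) : downSum (fun u => F u + G u) y = downSum F y + downSum G y := by
  simp [downSum, List.sum_map_add]
theorem upSum_mul (a : ℚ) (F) (y) : upSum (fun u => a * F u) y = a * upSum F y := by
  simp [upSum, List.sum_map_mul_left]
theorem downSum_mul (a : ℚ) (F) (y) : downSum (fun u => a * F u) y = a * downSum F y := by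
  simp [downSum, List.sum_map_mul_left]
@[simp] theorem upSum_zero (y) : upSum (fun _ => 0) y = 0 := by simp [upSum]
@[simp] theorem downSum_zero (y) : downSum (fun _ => 0) y = 0 := by simp [downSum]
theorem upSum_sum {ι : Type*} (s : Finset ι) (F : ι → List Digit → ℚ) (y) :
    upSum (fun u => ∑ i ∈ s, F i u) y = ∑ i ∈ s, upSum (F i) y := by
  classical
  induction s using Finset.induction_on with
  | empty => simp
  | insert a s ha ih => simp [Finset.sum_insert ha, upSum_add, ih]
theorem downSum_sum {ι : Type*} (s : Finset ι) (F : ι → List Digit → ℚ) (y) :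
    downSum (fun u => ∑ i ∈ s, F i u) y = ∑ i ∈ s, downSum (F i) y := by
  classical
  induction s using Finset.induction_on with
  | empty => simp
  | insert a s ha ih => simp [Finset.sum_insert ha, downSum_add, ih]

theorem rank_of_mem_upList {y u : List Digit} (h : u ∈ upList y) : rank u = rank y + 1 := by
  induction y generalizing u with
  | nil => simp_all [upList]
  | cons d v ih =>
    cases d <;> simp only [upList, List.mem_append, List.mem_map] at h <;>
      rcases h with ⟨a, ha, rfl⟩ | h
    · simp [ih ha]
    · split_ifs at h <;> simp_all
    · simp [ih ha]
    · split_ifs at h <;> simp_all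

theorem rank_of_mem_downList {y u : List Digit} (h : u ∈ downList y) : rank u + 1 = rank y := by
  induction y generalizing u with
  | nil => simp_all [downList]
  | cons d v ih =>
    cases d <;> simp only [downList, List.mem_append, List.mem_map] at h <;>
      rcases h with ⟨a, ha, rfl⟩ | h
    · simp [ih ha]
    · split_ifs at h <;> simp_all
    · simp [← ih ha]
    · split_ifs at h <;> simp_all

theorem upSum_congr {F G : List Digit → ℚ} {y : List Digit}
    (h : ∀ u, rank u = rank y + 1 → F u = G u) : upSum F y = upSum G y := by
  unfold upSum
  rw [List.map_congr_left fun u hu => h u (rank_of_mem_upList hu)]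
theorem downSum_congr {F G : List Digit → ℚ} {y : List Digit}
    (h : ∀ u, rank u + 1 = rank y → F u = G u) : downSum F y = downSum G y := by
  unfold downSum
  rw [List.map_congr_left fun u hu => h u (rank_of_mem_downList hu)]

/-! ### The differential relation UD = DU + 1 -/

/-- Both sides vanish unless `v` contains exactly one 1. Turning that 1 into a 2 gives the same word
as deleting it and attaching a last digit 2. -/
theorem upSum_allTwo (F : List Digit → ℚ) (v) :
    upSum (fun u => if allTwo u then F u else 0) v =
      downSum (fun u => if allTwo u then F (Digit.two :: u) else 0) v := by
  induction v generalizing F with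
  | nil => simp [allTwo]
  | cons d v ih =>
    cases d
    · by_cases h : allTwo v <;> simp [allTwo, h]
    · have := ih (fun u => F (Digit.two :: u))
      simp only [upSum_two, downSum_two, allTwo, Bool.false_eq_true, if_false, ite_self, add_zero]
      convert this <;> split_ifs <;> simp_all

/-- An upper neighbour of an all-2 word arises by inserting a 1: either at the right end, or with a
2 to its right, and then removing the last 2 leaves a lower neighbour of `v`. -/
theorem upSum_of_allTwo (F : List Digit → ℚ) {v} (hv : allTwo v) :
    upSum F v = downSum (fun u => F (Digit.two :: u)) v + F (Digit.one :: v) := by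
  induction v generalizing F with
  | nil => simp
  | cons d v ih =>
    cases d
    · simp [allTwo] at hv
    · have hv : allTwo v := hv
      simp [hv, ih _ hv]

/-- The Young–Fibonacci graph is a `1`-differential poset. -/
theorem upSum_downSum (F : List Digit → ℚ) (y) :
    upSum (downSum F) y = downSum (upSum F) y + F y := by
  induction y generalizing F with
  | nil => simp [allTwo]
  | cons d v ih =>
    cases d
    · have h1 := ih (fun u => F (Digit.one :: u))
      have h2 := upSum_allTwo F v
      by_cases h : allTwo v
      · have h3 := upSum_of_allTwo F h
        simp only [upSum_one, downSum_one, downSum_two, upSum_add, downSum_add, h, if_true]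
        linarith
      · simp only [upSum_one, downSum_one, upSum_add, downSum_add, h]
        simp only [Bool.false_eq_true, if_false]
        linarith
    · have h1 := ih (fun u => F (Digit.two :: u))
      have h2 := upSum_allTwo (fun u => F (Digit.one :: u)) v
      by_cases h : allTwo v
      · have h3 := upSum_of_allTwo (fun u => F (Digit.one :: u)) h
        have h4 : allTwo (Digit.two :: v) := h
        simp only [upSum_one, upSum_two, downSum_one, downSum_two, upSum_add, downSum_add, h,
          h4, if_true]
        linarith
      · simp only [upSum_two, downSum_two, upSum_add, downSum_add, h]
        simp only [Bool.false_eq_true, if_false]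
        linarith

/-! ### The upper product under U and D -/

/-- The product of the factors `g(y, j) - t`, for a word read from right to left. -/
def upperProd : ℚ → List Digit → ℚ
  | _, [] => 1
  | t, .one :: v => upperProd (t - 1) v
  | t, .two :: v => (1 - t) * upperProd (t - 2) v

/-- Induction on the last digit. The defect of the shorter word is cancelled by the deletion of a
last digit 1, while a last digit 2 passes it on; hence only all-2 words keep one. -/
theorem downSum_upperProd (t : ℚ) (y) : downSum (upperProd t) y =
    upperProd t y - if allTwo y then upperProd (t + 1) y else 0 := by
  induction y generalizing t with
  | nil => simp [upperProd, allTwo]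
  | cons d v ih =>
    cases d
    · have := ih (t - 1)
      by_cases h : allTwo v <;> simp_all [upperProd, allTwo]
    · have := ih (t - 2)
      have e : t + 1 - 2 = t - 1 := by ring
      have e' : t - 2 + 1 = t - 1 := by ring
      by_cases h : allTwo v <;> simp_all [upperProd, allTwo, downSum_mul]
      ring

theorem upSum_upperProd (t : ℚ) (y) : upSum (upperProd t) y =
    (rank y + 1 - t) * upperProd t y + if allTwo y then t * upperProd (t - 1) y else 0 := by
  induction y generalizing t with
  | nil => simp [upperProd, allTwo]
  | cons d v ih =>
    cases d
    · have := ih (t - 1)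
      have e : t - 1 - 1 = t - 2 := by ring
      simp only [upSum_one, upperProd, allTwo, this, rank_one, e]
      push_cast
      by_cases h : allTwo v
      · simp only [h, if_true]
        ring
      · simp only [h, Bool.false_eq_true, if_false]
        ring
    · have := ih (t - 2)
      have e : t - 1 - 2 = t - 2 - 1 := by ring
      by_cases h : allTwo v <;> simp_all [upperProd, allTwo, upSum_mul] <;> ring

/-! ### Cut weights and partial fractions -/

/-- The product of the reciprocals of `s + |v|` over all suffixes `v` of a word read from right
to left. -/
def sufProd : List Digit → ℚ → ℚ
  | [], s => s⁻¹
  | d :: w, s => s⁻¹ * sufProd w (s + d.val)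

/-- A recursion for `f(x, y, 0)`, for a word read from right to left. -/
def cutRev : List Digit → ℕ → ℚ
  | [], 0 => 1
  | [], _ + 1 => 0
  | d :: w, 0 => sufProd w d.val
  | .one :: w, i + 1 => -cutRev w i / (i + 1)
  | .two :: _, 1 => 0
  | .two :: w, i + 2 => -cutRev w i / (i + 2)

theorem sufProd_eq (w : List Digit) (s : ℚ) :
    ∏ k ∈ Finset.range (w.length + 1), ((rank (w.reverse.drop k) : ℚ) + s)⁻¹ = sufProd w s := by
  induction w generalizing s with
  | nil => simp [sufProd]
  | cons d w ih =>
    rw [List.length_cons, Finset.prod_range_succ, sufProd, ← ih, mul_comm]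
    congr 1
    · rw [List.drop_of_length_le (by simp)]; simp
    · refine Finset.prod_congr rfl fun k hk => ?_
      have hk : k ≤ w.reverse.length := by simpa [Nat.lt_succ_iff] using hk
      rw [List.reverse_cons, List.drop_append_of_le_length hk, rank_append]
      simp [rank]; ring

theorem cutWeight_append (u v : Word) (d : Digit) :
    cutWeight u (v ++ [d]) = cutWeight u v * (-(rank v + d.val : ℚ))⁻¹ := by
  have : ∏ k ∈ Finset.range v.length, (-(rank ((v ++ [d]).take (k + 1)) : ℚ))⁻¹ =
      ∏ k ∈ Finset.range v.length, (-(rank (v.take (k + 1)) : ℚ))⁻¹ := by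
    refine Finset.prod_congr rfl fun k hk => ?_
    rw [List.take_append_of_le_length (by simpa using hk)]
  rw [cutWeight, List.length_append, List.length_singleton, Finset.prod_range_succ, this,
    List.take_of_length_le (by simp), rank_append, cutWeight]
  simp [rank]; ring

/-- A cut either leaves the last digit in its right part, where it adds the factor -1/i, or has
empty right part, which requires i = 0. -/
theorem lowerZero_append (x : Word) (d : Digit) (i : ℕ) :
    lowerZero (x ++ [d]) i =
      (if d.val ≤ i then lowerZero x (i - d.val) * (-(i : ℚ))⁻¹ else 0) +
        if i = 0 then cutWeight (x ++ [d]) [] else 0 := by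
  rw [lowerZero, List.length_append, List.length_singleton, Finset.sum_range_succ]
  congr 1
  · split_ifs with h
    · rw [lowerZero, Finset.sum_mul]
      refine Finset.sum_congr rfl fun m hm => ?_
      have hm : m ≤ x.length := by simpa [Nat.lt_succ_iff] using hm
      rw [List.drop_append_of_le_length hm, List.take_append_of_le_length hm, rank_append]
      simp only [rank_cons, rank_nil]
      by_cases h1 : rank (x.drop m) = i - d.val
      · have h2 : rank (x.drop m) + (d.val + 0) = i := by omega
        have h3 : (i : ℚ) = rank (x.drop m) + d.val := by rw [← h2]; push_cast; ring
        rw [if_pos h1, if_pos h2, cutWeight_append, h3]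
      · have h2 : ¬ rank (x.drop m) + (d.val + 0) = i := by omega
        rw [if_neg h1, if_neg h2, zero_mul]
    · refine Finset.sum_eq_zero fun m hm => ?_
      have hm : m ≤ x.length := by simpa [Nat.lt_succ_iff] using hm
      rw [List.drop_append_of_le_length hm, rank_append]
      simp only [rank_cons]
      rw [if_neg (by omega)]
  · rw [List.drop_of_length_le (by simp), List.take_of_length_le (by simp)]
    simp [eq_comm]

theorem cutWeight_nil_right (w : List Digit) (d : Digit) :
    cutWeight (w.reverse ++ [d]) [] = sufProd w d.val := by
  rw [← sufProd_eq, cutWeight]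
  simp only [List.length_nil, Finset.range_zero, Finset.prod_empty, one_mul, List.length_append,
    List.length_reverse, List.length_singleton]
  refine Finset.prod_congr rfl fun k hk => ?_
  have hk : k ≤ w.reverse.length := by simpa [Nat.lt_succ_iff] using hk
  rw [List.drop_append_of_le_length hk, rank_append]
  simp [rank]

theorem lowerZero_reverse (w : List Digit) (i : ℕ) : lowerZero w.reverse i = cutRev w i := by
  induction w generalizing i with
  | nil => cases i <;> simp [lowerZero, cutRev, cutWeight]
  | cons d w ih =>
    rw [List.reverse_cons, lowerZero_append, cutWeight_nil_right, ih]
    rcases i with _ | _ | i <;> cases d <;> simp [cutRev, Digit.val, div_eq_mul_inv]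
    all_goals
      have h : (-(2 : ℚ) - i)⁻¹ = -(2 + (i : ℚ))⁻¹ := by rw [← inv_neg]; ring_nf
      ring_nf
      rw [h]
      ring

/-- This is the partial fraction expansion of `sufProd w` in s, with simple poles at -|v| for the
suffixes v. The induction step splits 1/((i+k)(i+k+s)), where k is the last digit. -/
theorem sum_cutRev_div (w : List Digit) (s : ℚ) (hs : 0 < s) :
    ∑ i ∈ Finset.range (rank w + 1), cutRev w i / (i + s) = sufProd w s := by
  induction w generalizing s with
  | nil => simp [cutRev, sufProd]
  | cons d w ih =>
    have key : ∀ k : ℚ, 0 < k → ∑ i ∈ Finset.range (rank w + 1),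
        -cutRev w i / (i + k) / (i + k + s) = s⁻¹ * (sufProd w (s + k) - sufProd w k) := by
      intro k hk
      rw [← ih _ hk, ← ih (s + k) (by positivity), ← Finset.sum_sub_distrib, Finset.mul_sum]
      refine Finset.sum_congr rfl fun i _ => ?_
      have : (0 : ℚ) ≤ i := by positivity
      field_simp
      ring
    cases d
    · have := key 1 one_pos
      rw [rank_one, Finset.sum_range_succ']
      simp only [cutRev, sufProd, Digit.val, Nat.cast_add, Nat.cast_one, Nat.cast_zero]
      rw [this]
      ring
    · have := key 2 two_pos
      rw [rank_two, Finset.sum_range_succ', Finset.sum_range_succ']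
      simp only [cutRev, sufProd, Digit.val, Nat.cast_add, Nat.cast_one, Nat.cast_zero,
        Nat.cast_ofNat, zero_add, zero_div, add_zero, add_assoc, one_add_one_eq_two] at this ⊢
      rw [this]
      ring

/-- For a word with last digit k, the terms with i > 0 add up to the negative of the expansion at s
= k of the remaining word, which is exactly the term i = 0. -/
theorem sum_cutRev (w : List Digit) :
    ∑ i ∈ Finset.range (rank w + 1), cutRev w i = if w = [] then 1 else 0 := by
  cases w with
  | nil => simp [cutRev]
  | cons d w =>
    cases d
    · have := sum_cutRev_div w 1 one_pos
      rw [rank_one, Finset.sum_range_succ']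
      simp only [cutRev, Digit.val, neg_div, Finset.sum_neg_distrib, Nat.cast_one, this]
      simp
    · have := sum_cutRev_div w 2 two_pos
      rw [rank_two, Finset.sum_range_succ', Finset.sum_range_succ']
      simp only [cutRev, Digit.val, neg_div, Finset.sum_neg_distrib, Nat.cast_ofNat, this]
      simp


/-! ### Recursions for the summands F_i -/

/-- The `i`-th summand of the path count as a function of the upper word, all words being read from
right to left. -/
def pathTerm (x : List Digit) (i : ℕ) (y : List Digit) : ℚ :=
  lowerRev x i (commonPrefix x y) * upperProd i y

theorem lowerRev_zero_right (w : List Digit) (i : ℕ) : lowerRev w i 0 = cutRev w i := by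
  rw [lowerRev.eq_def]
  cases w <;> simp [← lowerZero_reverse]

theorem lowerRev_one_zero (w : List Digit) (z : ℕ) :
    lowerRev (Digit.one :: w) 0 z = cutRev (Digit.one :: w) 0 := by
  cases z
  · rw [lowerRev_zero_right]
  · rw [lowerRev, lowerZero_reverse]

theorem lowerRev_one_succ (w : List Digit) (i z : ℕ) :
    lowerRev (Digit.one :: w) (i + 1) (z + 1) = cutRev (Digit.one :: w) (i + 1) + lowerRev w i z := by
  rw [lowerRev, lowerZero_reverse]

theorem lowerRev_two_one (w : List Digit) (z : ℕ) : lowerRev (Digit.two :: w) 1 z = 0 := by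
  cases z
  · rw [lowerRev_zero_right, cutRev]
  · rw [lowerRev, if_pos rfl]

theorem lowerRev_two_zero (w : List Digit) (z : ℕ) :
    lowerRev (Digit.two :: w) 0 z = cutRev (Digit.two :: w) 0 := by
  cases z
  · rw [lowerRev_zero_right]
  · rw [lowerRev, if_neg (by simp), lowerRev_one_zero]
    norm_num [cutRev, sufProd, Digit.val]

/-- Unfolding f at `11` produces two cut weights, whose sum is the cut weight for `2`:
1/((i+1)(i+2)) - 1/(i+1) = -1/(i+2). The factor on the left is the one that a last digit 2 of the
upper word contributes to `upperProd`, so `pathTerm_two_two` takes the shape of `pathTerm_one_one`.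
-/
theorem lowerRev_two_succ (w : List Digit) (i z : ℕ) :
    (1 - ((i : ℚ) + 2)) * lowerRev (Digit.two :: w) (i + 2) (z + 1) =
      cutRev (Digit.two :: w) (i + 2) + lowerRev w i z := by
  have h : (1 : ℚ) - ((i + 2 : ℕ) : ℚ) ≠ 0 := by
    push_cast
    have : (0 : ℚ) ≤ i := by positivity
    intro h
    linarith
  have h2 : (i : ℚ) + 2 ≠ 0 := by positivity
  have h1 : (i : ℚ) + 1 ≠ 0 := by positivity
  rw [lowerRev, if_neg (by omega), lowerRev_one_succ, lowerRev_one_succ]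
  push_cast at h ⊢
  rw [mul_div_cancel₀ _ h]
  simp only [cutRev]
  push_cast
  field_simp
  ring

theorem pathTerm_zero (x y : List Digit) : pathTerm x 0 y = cutRev x 0 * upperProd 0 y := by
  rw [pathTerm, Nat.cast_zero]
  rcases x with _ | ⟨_ | _, x⟩
  · rw [commonPrefix, lowerRev_zero_right] <;> simp
  · rw [lowerRev_one_zero]
  · rw [lowerRev_two_zero]

theorem pathTerm_nil_left (i : ℕ) (y : List Digit) :
    pathTerm [] i y = cutRev [] i * upperProd i y := by
  rw [pathTerm, commonPrefix, lowerRev_zero_right] <;> simp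

theorem pathTerm_nil_right (x : List Digit) (i : ℕ) : pathTerm x i [] = cutRev x i := by
  rw [pathTerm, commonPrefix, lowerRev_zero_right, upperProd, mul_one] <;> simp

theorem pathTerm_one_one (x : List Digit) (i : ℕ) (y : List Digit) :
    pathTerm (Digit.one :: x) (i + 1) (Digit.one :: y) =
      cutRev (Digit.one :: x) (i + 1) * upperProd i y + pathTerm x i y := by
  rw [pathTerm, commonPrefix, lowerRev_one_succ, upperProd, pathTerm]
  simp [add_mul]

theorem pathTerm_one_two (x : List Digit) (i : ℕ) (y : List Digit) :
    pathTerm (Digit.one :: x) i (Digit.two :: y) =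
      cutRev (Digit.one :: x) i * upperProd i (Digit.two :: y) := by
  rw [pathTerm, commonPrefix, lowerRev_zero_right] <;> simp

theorem pathTerm_two_two (x : List Digit) (i : ℕ) (y : List Digit) :
    pathTerm (Digit.two :: x) (i + 2) (Digit.two :: y) =
      cutRev (Digit.two :: x) (i + 2) * upperProd i y + pathTerm x i y := by
  rw [pathTerm, commonPrefix, upperProd, pathTerm, ← add_mul, ← lowerRev_two_succ]
  push_cast
  rw [add_sub_cancel_right]
  ring

theorem pathTerm_two_one (x : List Digit) (i : ℕ) (y : List Digit) :
    pathTerm (Digit.two :: x) i (Digit.one :: y) =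
      cutRev (Digit.two :: x) i * upperProd (i - 1) y := by
  rw [pathTerm, commonPrefix, lowerRev_zero_right, upperProd] <;> simp

theorem pathTerm_two_left_one (x y : List Digit) : pathTerm (Digit.two :: x) 1 y = 0 := by
  rw [pathTerm, lowerRev_two_one, zero_mul]

/-- On all-2 words the summand does not depend on the length of the common suffix. This makes the
defects of `upperProd`, which live on such words, computable. -/
theorem pathTerm_of_allTwo (x : List Digit) (i : ℕ) {y : List Digit} (hy : allTwo y) :
    pathTerm x i y = cutRev x i * upperProd i y := by
  induction x generalizing i y with
  | nil => exact pathTerm_nil_left i y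
  | cons d x ih =>
    rcases y with _ | ⟨_ | _, y⟩
    · rw [pathTerm_nil_right, upperProd, mul_one]
    · simp [allTwo] at hy
    · cases d
      · exact pathTerm_one_two ..
      · rcases i with _ | _ | i
        · rw [pathTerm_zero, Nat.cast_zero]
        · rw [pathTerm_two_left_one, cutRev, zero_mul]
        · rw [pathTerm_two_two, ih i (show allTwo y from hy), upperProd, cutRev]
          have h2 : (i : ℚ) + 2 ≠ 0 := by positivity
          push_cast
          rw [show (i : ℚ) + 1 + 1 - 2 = i by ring]
          field_simp
          ring

/-! ### The action of D and its source term -/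

/-- The defect of harmonicity of `pathTerm`: it is supported on the suffixes of `x`. -/
def pathSource : List Digit → ℕ → List Digit → ℚ
  | x, i, [] => cutRev x i
  | [], _, _ :: _ => 0
  | .one :: _, 0, .one :: _ => 0
  | .one :: x, i + 1, .one :: y => pathSource x i y
  | .one :: _, _, .two :: _ => 0
  | .two :: _, _, .one :: _ => 0
  | .two :: x, i + 2, .two :: y => pathSource x i y
  | .two :: _, _, .two :: _ => 0

theorem pathSource_zero_cons (x : List Digit) (d : Digit) (y : List Digit) :
    pathSource x 0 (d :: y) = 0 := by
  rcases x with _ | ⟨_ | _, x⟩ <;> cases d <;> simp [pathSource]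

theorem pathSource_two_one_cons (x : List Digit) (d : Digit) (y : List Digit) :
    pathSource (Digit.two :: x) 1 (d :: y) = 0 := by
  cases d <;> simp [pathSource]

theorem downSum_pathTerm (x : List Digit) (i : ℕ) (y : List Digit) :
    downSum (pathTerm x i) y = pathTerm x i y - pathSource x i y := by
  induction x generalizing i y with
  | nil =>
    have h : pathTerm [] i = fun y => cutRev [] i * upperProd i y := funext (pathTerm_nil_left i)
    rw [h, downSum_mul, downSum_upperProd]
    rcases i with _ | i
    · rcases y with _ | ⟨_ | _, y⟩ <;> simp [cutRev, pathSource, allTwo, upperProd]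
    · rcases y with _ | ⟨_ | _, y⟩ <;> simp [cutRev, pathSource]
  | cons d x ih =>
    rcases y with _ | ⟨e, y⟩
    · simp [pathTerm_nil_right, pathSource]
    · rcases i with _ | i
      · have h : pathTerm (d :: x) 0 = fun y => cutRev (d :: x) 0 * upperProd 0 y :=
          funext (pathTerm_zero _)
        rw [h, downSum_mul, downSum_upperProd, pathSource_zero_cons]
        -- The defect involves `upperProd 1`, which vanishes on a word ending in 2 because its first
        -- factor is 1 - 1.
        cases e <;> simp [allTwo, upperProd]
      · cases d
        · cases e
          · simp only [downSum_one, pathTerm_one_one, downSum_add, downSum_mul, ih, pathSource,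
              downSum_upperProd]
            by_cases h : allTwo y
            · simp only [h, if_true, pathTerm_of_allTwo _ _ h]
              push_cast
              ring
            · simp only [h]
              simp only [Bool.false_eq_true, if_false]
              ring
          -- Lowering the last 2 to 1 creates a common last digit with `x`; for all-2 `y` the extra
          -- summand this brings cancels the defect of `upperProd`.
          · have h0 := downSum_upperProd ((i + 1 : ℕ) : ℚ) (Digit.two :: y)
            simp only [downSum_two] at h0
            simp only [downSum_two, pathTerm_one_two, pathTerm_one_one, downSum_mul, pathSource]
            by_cases h : allTwo y
            · have h4 : allTwo (Digit.two :: y) := h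
              simp only [h, h4, if_true, pathTerm_of_allTwo _ _ h] at h0 ⊢
              simp only [upperProd, cutRev] at h0 ⊢
              push_cast at h0 ⊢
              have h2 : (i : ℚ) + 1 ≠ 0 := by positivity
              rw [add_sub_cancel_right] at h0
              rw [show (i : ℚ) + 1 + 1 - 2 = i by ring] at h0
              field_simp
              linear_combination (-cutRev x i) * h0
            · have h4 : ¬ allTwo (Digit.two :: y) := h
              simp only [h, h4] at h0 ⊢
              simp only [Bool.false_eq_true, if_false, add_zero, sub_zero] at h0 ⊢
              rw [h0]
        · rcases i with _ | i
          · have h : pathTerm (Digit.two :: x) (0 + 1) = fun y => 0 :=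
              funext (pathTerm_two_left_one _)
            rw [h, zero_add, pathSource_two_one_cons]
            simp
          · cases e
            · simp only [downSum_one, pathTerm_two_one, downSum_mul, pathSource,
                downSum_upperProd]
              by_cases h : allTwo y
              · simp only [h, if_true, pathTerm_of_allTwo _ _ h]
                push_cast
                rw [show (i : ℚ) + 1 + 1 - 1 + 1 = i + 1 + 1 by ring]
                ring
              · simp only [h]
                simp only [Bool.false_eq_true, if_false]
                ring
            · simp only [downSum_two, pathTerm_two_one, pathTerm_two_two, downSum_add,
                downSum_mul, ih, pathSource, downSum_upperProd]
              by_cases h : allTwo y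
              · simp only [h, if_true]
                push_cast
                rw [show (i : ℚ) + 1 + 1 - 1 = i + 1 by ring]
                ring
              · simp only [h]
                simp only [Bool.false_eq_true, if_false]
                ring

theorem pathSource_eq_zero {x y : List Digit} (h : rank x < rank y) (i : ℕ) :
    pathSource x i y = 0 := by
  induction x generalizing i y with
  | nil =>
    rcases y with _ | ⟨e, y⟩
    · simp at h
    · rw [pathSource]
  | cons d x ih =>
    rcases y with _ | ⟨e, y⟩
    · simp at h
    · rcases i with _ | _ | i <;> cases d <;> cases e <;> simp only [pathSource] <;>
        exact ih (by simpa using h) _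

-- At a suffix y of `x` the source is the cut weight of the rest of `x` at i - |y|. By `sum_cutRev`
-- the sum over i survives only when that rest is empty.
open Classical in
theorem sum_pathSource (x y : List Digit) :
    ∑ i ∈ Finset.range (rank x + 1), pathSource x i y = if y = x then 1 else 0 := by
  induction x generalizing y with
  | nil =>
    rcases y with _ | ⟨e, y⟩ <;> simp [pathSource, cutRev]
  | cons d x ih =>
    rcases y with _ | ⟨e, y⟩
    · simp only [pathSource, sum_cutRev]
      simp
    · cases d
      · rw [rank_one, Finset.sum_range_succ']
        cases e <;> simp [pathSource, ih]
      · rw [rank_two, Finset.sum_range_succ', Finset.sum_range_succ']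
        cases e <;> simp [pathSource, ih]

/-! ### The action of U and the normalisation on level |x| -/

/-- The defects of `upperProd` cancel as for D. The rank condition serves to exclude that `y` is a
proper suffix of `x`. -/
theorem upSum_pathTerm {x y : List Digit} (h : rank x ≤ rank y) (i : ℕ) :
    upSum (pathTerm x i) y = (rank y + 1 - i) * pathTerm x i y := by
  induction x generalizing i y with
  | nil =>
    have h : pathTerm [] i = fun y => cutRev [] i * upperProd i y := funext (pathTerm_nil_left i)
    rw [h, upSum_mul, upSum_upperProd]
    rcases i with _ | i <;> simp [cutRev]
  | cons d x ih =>
    rcases y with _ | ⟨e, y⟩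
    · cases d <;> simp at h
    · rcases i with _ | i
      · have h : pathTerm (d :: x) 0 = fun y => cutRev (d :: x) 0 * upperProd 0 y :=
          funext (pathTerm_zero _)
        rw [h, upSum_mul, upSum_upperProd]
        simp
        ring
      · cases d
        · cases e
          · have h1 := ih (y := y) (by simpa using h) i
            simp only [upSum_one, pathTerm_one_one, pathTerm_one_two, upSum_add, upSum_mul, h1,
              upSum_upperProd, rank_one]
            by_cases h : allTwo y
            · simp only [h, if_true, upperProd]
              push_cast
              rw [show (i : ℚ) + 1 - 2 = i - 1 by ring]
              ring
            · simp only [h]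
              simp only [Bool.false_eq_true, if_false]
              push_cast
              ring
          · have h0 := upSum_upperProd ((i + 1 : ℕ) : ℚ) (Digit.two :: y)
            simp only [upSum_two] at h0
            simp only [upSum_two, pathTerm_one_two, pathTerm_one_one, upSum_mul]
            by_cases h : allTwo y
            · have h4 : allTwo (Digit.two :: y) := h
              simp only [h, h4, if_true, pathTerm_of_allTwo _ _ h4] at h0 ⊢
              simp only [upperProd, cutRev] at h0 ⊢
              push_cast at h0 ⊢
              have h2 : (i : ℚ) + 1 ≠ 0 := by positivity
              rw [add_sub_cancel_right] at h0
              field_simp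
              linear_combination (-cutRev x i) * h0
            · have h4 : ¬ allTwo (Digit.two :: y) := h
              simp only [h, h4] at h0 ⊢
              simp only [Bool.false_eq_true, if_false, add_zero] at h0 ⊢
              rw [h0]
              ring
        · rcases i with _ | i
          · have h : pathTerm (Digit.two :: x) (0 + 1) = fun y => 0 :=
              funext (pathTerm_two_left_one _)
            rw [h]
            simp
          · cases e
            · simp only [upSum_one, pathTerm_two_one, upSum_mul, upSum_upperProd, rank_one]
              by_cases h : allTwo y
              · have h4 : allTwo (Digit.two :: y) := h
                simp only [h, if_true, pathTerm_of_allTwo _ _ h4, upperProd]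
                push_cast
                rw [show (i : ℚ) + 1 + 1 - 2 = i by ring, show (i : ℚ) + 1 + 1 - 1 - 1 = i by ring]
                ring
              · simp only [h]
                simp only [Bool.false_eq_true, if_false]
                push_cast
                ring
            · have h1 := ih (y := y) (by simpa using h) i
              simp only [upSum_two, pathTerm_two_one, pathTerm_two_two, upSum_add, upSum_mul, h1,
                upSum_upperProd, rank_two]
              by_cases h : allTwo y
              · simp only [h, if_true, upperProd]
                push_cast
                rw [show (i : ℚ) + 1 + 1 - 1 - 2 = i - 1 by ring]
                ring
              · simp only [h]
                simp only [Bool.false_eq_true, if_false]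
                push_cast
                ring

-- Summing `downSum_pathTerm` over i gives S = D S + δ_x for the sum S. Lower neighbours of `y` have
-- rank below |x|, so D S vanishes at `y` by induction on the rank.
open Classical in
theorem sum_pathTerm {x y : List Digit} (h : rank y ≤ rank x) :
    ∑ i ∈ Finset.range (rank x + 1), pathTerm x i y = if y = x then 1 else 0 := by
  induction hn : rank y using Nat.strong_induction_on generalizing y with
  | _ n ih =>
    have h1 : downSum (fun u => ∑ i ∈ Finset.range (rank x + 1), pathTerm x i u) y = 0 := by
      rw [downSum_congr (G := fun _ => 0), downSum_zero]
      intro u hu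
      rw [ih (rank u) (by omega) (by omega) rfl, if_neg]
      rintro rfl
      omega
    rw [downSum_sum] at h1
    simp only [downSum_pathTerm, Finset.sum_sub_distrib, sum_pathSource] at h1
    linarith


/-! ### Extension below level |x| -/

/-- The extension of `pathTerm x i` to words of rank less than `|x|` by iterated upper sums. -/
def extTerm (x : List Digit) (i : ℕ) (y : List Digit) : ℚ :=
  upSum^[rank x - rank y] (pathTerm x i) y

theorem extTerm_of_le {x y : List Digit} (h : rank x ≤ rank y) (i : ℕ) :
    extTerm x i y = pathTerm x i y := by
  rw [extTerm, Nat.sub_eq_zero_of_le h, Function.iterate_zero, id]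

theorem downSum_pathTerm_of_lt {x y : List Digit} (h : rank x < rank y) (i : ℕ) :
    downSum (pathTerm x i) y = pathTerm x i y := by
  rw [downSum_pathTerm, pathSource_eq_zero h, sub_zero]

theorem upSum_extTerm_of_le {x y : List Digit} (h : rank x ≤ rank y) (i : ℕ) :
    upSum (extTerm x i) y = (rank y + 1 - i) * extTerm x i y := by
  rw [extTerm_of_le h, ← upSum_pathTerm h]
  exact upSum_congr fun u hu => extTerm_of_le (by omega) i

theorem upSum_extTerm_of_lt {x y : List Digit} (h : rank y < rank x) (i : ℕ) :
    upSum (extTerm x i) y = extTerm x i y := by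
  have e : rank x - rank y = (rank x - rank y - 1) + 1 := by omega
  rw [extTerm, e, Function.iterate_succ_apply']
  refine upSum_congr fun u hu => ?_
  rw [extTerm, show rank x - rank u = rank x - rank y - 1 by omega]

theorem downSum_extTerm_of_lt {x y : List Digit} (h : rank x < rank y) (i : ℕ) :
    downSum (extTerm x i) y = extTerm x i y := by
  rw [extTerm_of_le h.le, ← downSum_pathTerm_of_lt h]
  exact downSum_congr fun u hu => extTerm_of_le (by omega) i

/-- Commuting D past one U by UD = DU + 1 lowers the factor |y| + 1 - i to |y| - i. The base case,
on level |x|, uses D F_i = F_i one level higher and the eigenvalue of U. -/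
theorem downSum_iterate_upSum {x : List Digit} (i m : ℕ) {y : List Digit}
    (h : rank y + m = rank x) :
    downSum (upSum^[m + 1] (pathTerm x i)) y =
      (rank y - i) * upSum^[m] (pathTerm x i) y := by
  induction m generalizing y with
  | zero =>
    have h1 := upSum_downSum (pathTerm x i) y
    rw [upSum_congr fun u hu => downSum_pathTerm_of_lt (x := x) (y := u) (by omega) i,
      upSum_pathTerm (by omega)] at h1
    simp only [zero_add, Function.iterate_one, Function.iterate_zero, id]
    linarith
  | succ m ih =>
    have h1 := upSum_downSum (upSum^[m + 1] (pathTerm x i)) y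
    rw [upSum_congr (G := fun u => (rank y + 1 - i : ℚ) * upSum^[m] (pathTerm x i) u)
      fun u hu => by rw [ih (y := u) (by omega), hu]; push_cast; ring, upSum_mul,
      ← Function.iterate_succ_apply' upSum, ← Function.iterate_succ_apply' upSum] at h1
    linarith

theorem downSum_extTerm_of_le {x y : List Digit} (h : rank y ≤ rank x) (i : ℕ) :
    downSum (extTerm x i) y = (rank y - i) * extTerm x i y := by
  rw [extTerm, ← downSum_iterate_upSum i (rank x - rank y) (by omega)]
  refine downSum_congr fun u hu => ?_
  rw [extTerm, show rank x - rank u = rank x - rank y + 1 by omega]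

/-! ### Counting along a trajectory -/

/-- The neighbours of rank `b` of a word, all words being read from right to left. -/
def neighbors (y : List Digit) (b : ℕ) : List (List Digit) :=
  if b = rank y + 1 then upList y else if b + 1 = rank y then downList y else []

open Classical in
/-- The number of paths from `y` to `x` whose ranks after the first one are given by the list. -/
noncomputable def pathCount (x : List Digit) : List Digit → List ℕ → ℕ
  | y, [] => if y = x then 1 else 0
  | y, b :: l => ((neighbors y b).map fun u => pathCount x u l).sum

/-- The factor by which a trajectory, given by its first term and the list of its further terms,
multiplies `extTerm`. -/
def stepWeight (n i : ℕ) : ℕ → List ℕ → ℚ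
  | _, [] => 1
  | a, b :: l => (if b = a + 1 then (if n ≤ a then (b - i : ℚ) else 1)
      else if n < a then 1 else (a - i : ℚ)) * stepWeight n i b l

/-- The product of the factors `e(Δ, j) - i` of a trajectory, given by its first term and the list
of its further terms. -/
def upStepProd (i : ℕ) : ℕ → List ℕ → ℚ
  | _, [] => 1
  | a, b :: l => (if b = a + 1 then (b - i : ℚ) else 1) * upStepProd i b l

/-- The product over the levels in (a, n] records the up-steps still owed to return to level n. An
up-step below n pays one factor off, a down-step from a level ≤ n adds one, and at or above n the
product is empty. -/
theorem stepWeight_mul_prod {n i a : ℕ} {l : List ℕ}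
    (hl : (a :: l).IsChain (fun a b => b = a + 1 ∨ a = b + 1))
    (hn : (a :: l).getLast? = some n) :
    stepWeight n i a l * ∏ k ∈ Finset.Ioc a n, (k - i : ℚ) = upStepProd i a l := by
  induction l generalizing a with
  | nil =>
    obtain rfl : a = n := by simpa using hn
    simp [stepWeight, upStepProd]
  | cons b l ih =>
    rw [List.isChain_cons_cons] at hl
    rw [List.getLast?_cons_cons] at hn
    have peel : ∀ c, c < n → ∏ k ∈ Finset.Ioc c n, (k - i : ℚ) =
        ((c + 1 : ℕ) - i : ℚ) * ∏ k ∈ Finset.Ioc (c + 1) n, (k - i : ℚ) := by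
      intro c hc
      rw [← Finset.insert_Ioc_add_one_left_eq_Ioc hc, Finset.prod_insert (by simp)]
    rw [stepWeight, upStepProd, ← ih hl.2 hn]
    rcases hl.1 with rfl | rfl
    · by_cases h : n ≤ a
      · simp [h, Finset.Ioc_eq_empty_of_le, h.trans (Nat.le_succ a)]
      · rw [peel a (by omega)]
        simp [h]
        ring
    · by_cases h : n < b + 1
      · simp [h, Finset.Ioc_eq_empty_of_le, h.le, Nat.lt_succ_iff.1 h]
      · have hb : ¬ b = b + 1 + 1 := by omega
        rw [peel b (by omega), if_neg hb, if_neg hb, if_neg h]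
        ring

/-- The first step acts on the count of the remaining trajectory as U or D, and every extended
summand is multiplied by a scalar depending only on the level. The empty trajectory is the
normalisation on level |x|. -/
theorem pathCount_eq_sum {x y : List Digit} {l : List ℕ}
    (hl : (rank y :: l).IsChain (fun a b => b = a + 1 ∨ a = b + 1))
    (hn : (rank y :: l).getLast? = some (rank x)) :
    (pathCount x y l : ℚ) = ∑ i ∈ Finset.range (rank x + 1),
      stepWeight (rank x) i (rank y) l * extTerm x i y := by
  classical
  induction l generalizing y with
  | nil =>
    have h : rank y = rank x := by simpa using hn
    rw [pathCount, Finset.sum_congr rfl fun i _ => by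
      rw [stepWeight, one_mul, extTerm_of_le h.ge], sum_pathTerm h.le]
    push_cast
    rfl
  | cons b l ih =>
    rw [List.isChain_cons_cons] at hl
    rw [List.getLast?_cons_cons] at hn
    rcases hl.1 with rfl | hb
    · have h1 : (pathCount x y ((rank y + 1) :: l) : ℚ) =
          upSum (fun u => ∑ i ∈ Finset.range (rank x + 1),
            stepWeight (rank x) i (rank y + 1) l * extTerm x i u) y := by
        rw [pathCount, neighbors, if_pos rfl, ← upSum_congr (F := fun u => (pathCount x u l : ℚ)),
          upSum]
        · push_cast [List.map_map]
          rfl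
        · intro u hu
          rw [← hu] at hl hn ⊢
          exact ih hl.2 hn
      rw [h1, upSum_sum]
      refine Finset.sum_congr rfl fun i _ => ?_
      rw [upSum_mul, stepWeight, if_pos rfl]
      split_ifs with h
      · rw [upSum_extTerm_of_le h]
        push_cast
        ring
      · rw [upSum_extTerm_of_lt (by omega)]
        ring
    · have hb' : ¬ b = rank y + 1 := by omega
      have h1 : (pathCount x y (b :: l) : ℚ) =
          downSum (fun u => ∑ i ∈ Finset.range (rank x + 1),
            stepWeight (rank x) i b l * extTerm x i u) y := by
        rw [pathCount, neighbors, if_neg hb', if_pos hb.symm,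
          ← downSum_congr (F := fun u => (pathCount x u l : ℚ)), downSum]
        · push_cast [List.map_map]
          rfl
        · intro u hu
          obtain rfl : rank u = b := by omega
          exact ih hl.2 hn
      rw [h1, downSum_sum]
      refine Finset.sum_congr rfl fun i _ => ?_
      rw [downSum_mul, stepWeight, if_neg hb']
      split_ifs with h
      · rw [downSum_extTerm_of_lt h]
        ring
      · rw [downSum_extTerm_of_le (by omega)]
        ring

theorem pathCount_eq {x y : List Digit} {l : List ℕ} (hxy : rank x ≤ rank y)
    (hl : (rank y :: l).IsChain (fun a b => b = a + 1 ∨ a = b + 1))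
    (hn : (rank y :: l).getLast? = some (rank x)) :
    (pathCount x y l : ℚ) = ∑ i ∈ Finset.range (rank x + 1),
      pathTerm x i y * upStepProd i (rank y) l := by
  rw [pathCount_eq_sum hl hn]
  refine Finset.sum_congr rfl fun i _ => ?_
  rw [← stepWeight_mul_prod hl hn, Finset.Ioc_eq_empty_of_le hxy, extTerm_of_le hxy,
    Finset.prod_empty, mul_one, mul_comm]

/-! ### Upper and middle products in recursive form -/

theorem twos_append (v w : Word) : twos (v ++ w) = twos v + twos w := by
  induction v with
  | nil => simp [twos]
  | cons d v ih => cases d <;> simp [twos, ih]; ring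

theorem twos_reverse (w : Word) : twos w.reverse = twos w := by
  induction w with
  | nil => rfl
  | cons d w ih => cases d <;> simp [twos, twos_append, ih]

/-- A last digit 1 raises every g by 1; a last digit 2 raises them by 2 and contributes a new first
value g = 1. -/
theorem prod_runRev (w : List Digit) (t : ℚ) :
    ∏ m ∈ Finset.range (twos w),
      ((∑ l ∈ Finset.range (m + 1), (runRev w l : ℚ)) + 2 * (m + 1) - 1 - t) = upperProd t w := by
  induction w generalizing t with
  | nil => simp [twos, upperProd]
  | cons d w ih =>
    cases d
    · rw [twos, upperProd, ← ih]
      refine Finset.prod_congr rfl fun m _ => ?_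
      rw [Finset.sum_range_succ', Finset.sum_range_succ' (fun l => (runRev w l : ℚ))]
      simp only [runRev]
      push_cast
      ring
    · rw [twos, upperProd, ← ih, Finset.prod_range_succ', mul_comm]
      congr 1
      · simp [runRev]
        ring
      · refine Finset.prod_congr rfl fun m _ => ?_
        rw [Finset.sum_range_succ']
        simp only [runRev]
        push_cast
        ring

theorem prod_Icc_one {M : Type*} [CommMonoid M] (n : ℕ) (F : ℕ → M) :
    ∏ j ∈ Finset.Icc 1 n, F j = ∏ k ∈ Finset.range n, F (k + 1) := by
  induction n with
  | zero => simp
  | succ n ih => rw [Finset.prod_Icc_succ_top (by omega), Finset.prod_range_succ, ih]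

theorem prod_upper (y : Word) (t : ℚ) :
    ∏ j ∈ Finset.Icc 1 (twos y), ((upper y j : ℚ) - t) = upperProd t y.reverse := by
  rw [← prod_runRev, twos_reverse, prod_Icc_one]
  refine Finset.prod_congr rfl fun m _ => ?_
  simp [upper, run]

theorem prod_middle (Δ : List ℕ) (i : ℕ) :
    ∏ j ∈ Finset.Icc 1 (numUp Δ), ((middle Δ j : ℚ) - i) =
      ∏ k ∈ upSteps Δ, ((level Δ k : ℚ) - i) := by
  have hf : (Set.ofPred (· ∈ upSteps Δ)).Finite := (upSteps Δ).finite_toSet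
  have hc : hf.toFinset.card = numUp Δ := by
    rw [numUp]; congr 1; ext; rw [Set.Finite.mem_toFinset]; rfl
  -- Up-steps are numbered from 1, but `Nat.nth` counts from 0; hence the shifts by one below.
  refine Finset.prod_nbij (upIndex Δ) ?_ ?_ ?_ fun _ _ => rfl
  · intro j hj
    rw [Finset.mem_Icc] at hj
    exact Nat.nth_mem_of_lt_card hf (by omega)
  · intro j hj k hk h
    simp only [Finset.coe_Icc, Set.mem_Icc] at hj hk
    have := Nat.nth_injOn hf (show j - 1 ∈ Set.Iio _ by simp only [Set.mem_Iio]; omega)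
      (show k - 1 ∈ Set.Iio _ by simp only [Set.mem_Iio]; omega) h
    omega
  · intro k hk
    obtain ⟨m, hm, rfl⟩ := Nat.exists_lt_card_finite_nth_eq hf hk
    refine ⟨m + 1, ?_, rfl⟩
    simp only [Finset.coe_Icc, Set.mem_Icc]
    omega

theorem prod_range_level (a : ℕ) (l : List ℕ) (i : ℕ) :
    ∏ k ∈ Finset.range l.length, (if level (a :: l) (k + 1) = level (a :: l) k + 1
      then (level (a :: l) (k + 1) - i : ℚ) else 1) = upStepProd i a l := by
  induction l generalizing a with
  | nil => simp [upStepProd]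
  | cons b l ih =>
    rw [List.length_cons, Finset.prod_range_succ', upStepProd, ← ih, mul_comm]
    simp [level]

theorem prod_middle_cons (a : ℕ) (l : List ℕ) (i : ℕ) :
    ∏ j ∈ Finset.Icc 1 (numUp (a :: l)), ((middle (a :: l) j : ℚ) - i) = upStepProd i a l := by
  rw [prod_middle, ← prod_range_level, upSteps, Finset.prod_filter, prod_Icc_one]
  simp

/-! ### From neighbour lists to walks in the graph -/

theorem upList_nodup (y : List Digit) : (upList y).Nodup := by
  induction y with
  | nil => simp [upList]
  | cons d v ih =>
    cases d <;> rw [upList] <;> refine List.Nodup.append (ih.map (List.cons_injective)) ?_ ?_ <;>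
      by_cases h : allTwo v <;> simp [h, List.disjoint_left]

theorem downList_nodup (y : List Digit) : (downList y).Nodup := by
  induction y with
  | nil => simp [downList]
  | cons d v ih =>
    cases d <;> rw [downList] <;> refine List.Nodup.append (ih.map (List.cons_injective)) ?_ ?_ <;>
      by_cases h : allTwo v <;> simp [h, List.disjoint_left]
    rintro u - rfl
    simp [allTwo] at h

theorem allTwo_iff (v : List Digit) : allTwo v ↔ ∃ k, v = List.replicate k Digit.two := by
  constructor
  · intro h
    induction v with
    | nil => exact ⟨0, rfl⟩
    | cons d v ih =>
      cases d
      · simp [allTwo] at h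
      · obtain ⟨k, rfl⟩ := ih h
        exact ⟨k + 1, rfl⟩
  · rintro ⟨k, rfl⟩
    induction k with
    | zero => rfl
    | succ k ih => exact ih

theorem upEdge_reverse_iff (a b : List Digit) : UpEdge a.reverse b.reverse ↔
    (∃ w v, allTwo v ∧ a = w ++ Digit.one :: v ∧ b = w ++ Digit.two :: v) ∨
      ∃ w v, allTwo v ∧ a = w ++ v ∧ b = w ++ Digit.one :: v := by
  have e : ∀ (u v : List Digit), u.reverse = v ↔ u = v.reverse := fun u v =>
    List.reverse_eq_iff
  simp only [UpEdge, e, allTwo_iff]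
  constructor
  · rintro (⟨k, w, rfl, rfl⟩ | ⟨k, w, rfl, rfl⟩)
    · exact Or.inl ⟨w.reverse, _, ⟨k, rfl⟩, by simp, by simp⟩
    · exact Or.inr ⟨w.reverse, _, ⟨k, rfl⟩, by simp, by simp⟩
  · rintro (⟨w, _, ⟨k, rfl⟩, rfl, rfl⟩ | ⟨w, _, ⟨k, rfl⟩, rfl, rfl⟩)
    · exact Or.inl ⟨k, w.reverse, by simp, by simp⟩
    · exact Or.inr ⟨k, w.reverse, by simp, by simp⟩

theorem mem_upList_iff (a b : List Digit) : b ∈ upList a ↔ UpEdge a.reverse b.reverse := by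
  rw [upEdge_reverse_iff]
  constructor
  · intro h
    induction a generalizing b with
    | nil =>
      obtain rfl : b = [Digit.one] := by simpa [upList] using h
      exact Or.inr ⟨[], [], rfl, rfl, rfl⟩
    | cons d v ih =>
      have lift : ∀ c, c ∈ upList v → (∃ w u, allTwo u ∧ d :: v = w ++ Digit.one :: u ∧
          d :: c = w ++ Digit.two :: u) ∨
          ∃ w u, allTwo u ∧ d :: v = w ++ u ∧ d :: c = w ++ Digit.one :: u := by
        intro c hc
        rcases ih c hc with ⟨w, u, hu, rfl, rfl⟩ | ⟨w, u, hu, rfl, rfl⟩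
        · exact Or.inl ⟨d :: w, u, hu, rfl, rfl⟩
        · exact Or.inr ⟨d :: w, u, hu, rfl, rfl⟩
      cases d <;> rw [upList, List.mem_append, List.mem_map] at h <;>
        rcases h with ⟨c, hc, rfl⟩ | h
      · exact lift c hc
      · split_ifs at h with hv
        · obtain rfl : b = Digit.two :: v := by simpa using h
          exact Or.inl ⟨[], v, hv, rfl, rfl⟩
        · simp at h
      · exact lift c hc
      · split_ifs at h with hv
        · obtain rfl : b = Digit.one :: Digit.two :: v := by simpa using h
          exact Or.inr ⟨[], Digit.two :: v, hv, rfl, rfl⟩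
        · simp at h
  · have lift : ∀ (w : List Digit) (u v : List Digit), v ∈ upList u → w ++ v ∈ upList (w ++ u) := by
      intro w u v h
      induction w with
      | nil => exact h
      | cons d w ih => cases d <;> simp [upList, ih]
    rintro (⟨w, v, hv, rfl, rfl⟩ | ⟨w, v, hv, rfl, rfl⟩) <;> refine lift w _ _ ?_
    · simp [upList, hv]
    -- `upList` records a 1 inserted to the right of a nonempty all-2 block at the rightmost 2 of
    -- that block, so the block has to be split.
    · rcases v with _ | ⟨_ | _, v⟩
      · simp [upList]
      · simp [allTwo] at hv
      · simp [upList, show allTwo v from hv]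

theorem mem_downList_iff_mem_upList (a b : List Digit) : b ∈ downList a ↔ a ∈ upList b := by
  rw [mem_upList_iff, upEdge_reverse_iff]
  constructor
  · intro h
    induction a generalizing b with
    | nil => simp [downList] at h
    | cons d v ih =>
      have lift : ∀ c, c ∈ downList v → (∃ w u, allTwo u ∧ d :: c = w ++ Digit.one :: u ∧
          d :: v = w ++ Digit.two :: u) ∨
          ∃ w u, allTwo u ∧ d :: c = w ++ u ∧ d :: v = w ++ Digit.one :: u := by
        intro c hc
        rcases ih c hc with ⟨w, u, hu, rfl, rfl⟩ | ⟨w, u, hu, rfl, rfl⟩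
        · exact Or.inl ⟨d :: w, u, hu, rfl, rfl⟩
        · exact Or.inr ⟨d :: w, u, hu, rfl, rfl⟩
      cases d <;> rw [downList, List.mem_append, List.mem_map] at h <;>
        rcases h with ⟨c, hc, rfl⟩ | h
      · exact lift c hc
      · split_ifs at h with hv
        · obtain rfl : b = v := by simpa using h
          exact Or.inr ⟨[], b, hv, rfl, rfl⟩
        · simp at h
      · exact lift c hc
      · split_ifs at h with hv
        · obtain rfl : b = Digit.one :: v := by simpa using h
          exact Or.inl ⟨[], v, hv, rfl, rfl⟩
        · simp at h
  · have lift : ∀ (w : List Digit) (u v : List Digit),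
        v ∈ downList u → w ++ v ∈ downList (w ++ u) := by
      intro w u v h
      induction w with
      | nil => exact h
      | cons d w ih => cases d <;> simp [downList, ih]
    rintro (⟨w, v, hv, rfl, rfl⟩ | ⟨w, v, hv, rfl, rfl⟩) <;> refine lift w _ _ ?_ <;>
      simp [downList, hv]

theorem mem_neighbors_iff (y u : List Digit) (b : ℕ) :
    u ∈ neighbors y b ↔ YF.Adj y.reverse u.reverse ∧ rank u = b := by
  have h1 : UpEdge y.reverse u.reverse → rank u = rank y + 1 := fun h => by simpa using h.rank_eq
  have h2 : UpEdge u.reverse y.reverse → rank y = rank u + 1 := fun h => by simpa using h.rank_eq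
  change _ ↔ (UpEdge _ _ ∨ UpEdge _ _) ∧ _
  rw [neighbors]
  split_ifs with h h'
  · rw [mem_upList_iff]
    exact ⟨fun e => ⟨Or.inl e, by rw [h1 e, h]⟩, fun e => e.1.resolve_right fun e' => by
      have := h2 e'; omega⟩
  · rw [mem_downList_iff_mem_upList, mem_upList_iff]
    exact ⟨fun e => ⟨Or.inr e, by have := h2 e; omega⟩, fun e => e.1.resolve_left fun e' => by
      have := h1 e'; omega⟩
  · simp only [List.not_mem_nil, false_iff]
    rintro ⟨e | e, rfl⟩
    · exact h (h1 e)
    · exact h' (h2 e).symm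

theorem neighbors_nodup (y : List Digit) (b : ℕ) : (neighbors y b).Nodup := by
  rw [neighbors]
  split_ifs
  · exact upList_nodup y
  · exact downList_nodup y
  · exact List.nodup_nil

/-- Prepending an edge to a path along a trajectory. -/
def consPath (x y : List Digit) (b : ℕ) (l : List ℕ) :
    (Σ u : {u // u ∈ neighbors y b}, pathsAlong x.reverse u.1.reverse (b :: l)) →
      pathsAlong x.reverse y.reverse (rank y :: b :: l) :=
  fun p => ⟨.cons ((mem_neighbors_iff y _ b).1 p.1.2).1 p.2.1, by
    have h : p.2.1.support.map rank = b :: l := p.2.2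
    simp [pathsAlong, h]⟩

theorem exists_eq_cons {a c : Word} (p : YF.Walk a c) {r b : ℕ} {l : List ℕ}
    (hp : p.support.map rank = r :: b :: l) :
    ∃ (u : Word) (h : YF.Adj a u) (q : YF.Walk u c),
      p = .cons h q ∧ q.support.map rank = b :: l := by
  rcases p with _ | ⟨h, q⟩
  · simp at hp
  · exact ⟨_, h, q, rfl, by simpa using (List.cons.inj hp).2⟩

theorem consPath_bijective (x y : List Digit) (b : ℕ) (l : List ℕ) :
    Function.Bijective (consPath x y b l) := by
  constructor
  · rintro ⟨⟨u, hu⟩, p, hp⟩ ⟨⟨v, hv⟩, q, hq⟩ h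
    have h := congrArg Subtype.val h
    simp only [consPath, SimpleGraph.Walk.cons.injEq] at h
    obtain rfl : u = v := List.reverse_injective h.1
    obtain rfl : p = q := eq_of_heq h.2
    rfl
  · rintro ⟨p, hp⟩
    obtain ⟨u, h, q, rfl, hq⟩ := exists_eq_cons p hp
    obtain ⟨u, rfl⟩ : ∃ v : List Digit, u = v.reverse := ⟨u.reverse, by simp⟩
    have hu : rank u = b := by
      have := congrArg List.head? hq
      rw [← SimpleGraph.Walk.cons_tail_support] at this
      simpa only [List.map_cons, List.head?_cons, Option.some.injEq, rank_reverse] using this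
    exact ⟨⟨⟨u, (mem_neighbors_iff y u b).2 ⟨h, hu⟩⟩, q, hq⟩, rfl⟩

/-- Removing the first edge is a bijection onto pairs of a neighbour and a shorter path. Since
neighbour lists have no repetitions, the list sum in `pathCount` counts each neighbour once. -/
theorem finite_pathsAlong (x y : List Digit) (l : List ℕ) :
    Finite (pathsAlong x.reverse y.reverse (rank y :: l)) ∧
      Nat.card (pathsAlong x.reverse y.reverse (rank y :: l)) = pathCount x y l := by
  classical
  induction l generalizing y with
  | nil =>
    have hlen : ∀ p ∈ pathsAlong x.reverse y.reverse [rank y], p.length = 0 := by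
      intro p hp
      have h := congrArg List.length (show p.support.map rank = [rank y] from hp)
      simpa using h
    have hs : Subsingleton (pathsAlong x.reverse y.reverse [rank y]) := by
      refine ⟨fun ⟨p, hp⟩ ⟨q, hq⟩ => Subtype.ext ?_⟩
      have h1 := hlen p hp
      have h2 := hlen q hq
      change p = q
      clear hp hq hlen
      generalize y.reverse = b at p q
      generalize x.reverse = a at p q
      cases p
      · cases q
        · rfl
        · simp at h2
      · simp at h1
    refine ⟨inferInstance, ?_⟩
    rw [pathCount]
    split_ifs with h
    · subst h
      have : Nonempty (pathsAlong y.reverse y.reverse [rank y]) :=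
        ⟨⟨.nil, by simp [pathsAlong]⟩⟩
      exact Nat.card_unique
    · have : IsEmpty (pathsAlong x.reverse y.reverse [rank y]) :=
        ⟨fun ⟨p, hp⟩ => h (List.reverse_injective (SimpleGraph.Walk.eq_of_length_eq_zero (hlen p hp)))⟩
      exact Nat.card_of_isEmpty
  | cons b l ih =>
    have ih' : ∀ u : {u // u ∈ neighbors y b},
        Finite (pathsAlong x.reverse u.1.reverse (b :: l)) ∧
          Nat.card (pathsAlong x.reverse u.1.reverse (b :: l)) = pathCount x u l := by
      rintro ⟨u, hu⟩
      obtain rfl := ((mem_neighbors_iff y u b).1 hu).2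
      exact ih u
    have := fun u => (ih' u).1
    have hb := consPath_bijective x y b l
    have : Fintype {u // u ∈ neighbors y b} :=
      Fintype.subtype (neighbors y b).toFinset (by simp)
    refine ⟨Finite.of_surjective _ hb.2, ?_⟩
    rw [← Nat.card_congr (Equiv.ofBijective _ hb), Nat.card_sigma, pathCount,
      ← List.sum_toFinset _ (neighbors_nodup y b)]
    rw [Finset.sum_congr rfl fun u _ => (ih' u).2]
    exact (Finset.sum_subtype (p := fun u => u ∈ neighbors y b) _ (fun u => List.mem_toFinset)
      fun u => pathCount x u l).symm

end YoungFib

theorem mainTheorem2 (x y : YoungFib.Word) (hxy : YoungFib.rank x ≤ YoungFib.rank y)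
    (Δ : List ℕ) (hΔ : YoungFib.IsTrajectory (YoungFib.rank y) (YoungFib.rank x) Δ) :
    (YoungFib.pathsAlong x y Δ).Finite ∧
      ((YoungFib.pathsAlong x y Δ).ncard : ℚ) =
        ∑ i ∈ Finset.range (YoungFib.rank x + 1),
          YoungFib.lower x i (YoungFib.commonSuffix x y) *
            (∏ j ∈ Finset.Icc 1 (YoungFib.twos y), ((YoungFib.upper y j : ℚ) - (i : ℚ))) *
            ∏ j ∈ Finset.Icc 1 (YoungFib.numUp Δ),
              ((YoungFib.middle Δ j : ℚ) - (i : ℚ)) := by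
  obtain ⟨-, hc, hh, hl⟩ := hΔ
  rcases Δ with _ | ⟨a, l⟩
  · simp at hh
  · obtain rfl : a = YoungFib.rank y := by simpa using hh
    have h := YoungFib.finite_pathsAlong x.reverse y.reverse l
    rw [List.reverse_reverse x, List.reverse_reverse y, YoungFib.rank_reverse] at h
    refine ⟨h.1, ?_⟩
    rw [← Nat.card_coe_set_eq, h.2, YoungFib.pathCount_eq (by simpa using hxy) (by simpa using hc)
      (by simpa using hl)]
    simp only [YoungFib.prod_middle_cons, YoungFib.prod_upper, YoungFib.rank_reverse,
      YoungFib.pathTerm, YoungFib.lower, YoungFib.commonSuffix]
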